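/- Let $G$ be a finite undirected graph (at most one edge per pair of vertices), made reflexive by allowing an agent to stay at its vertex for a unit of time; let $s,t$ be vertices of $G$, not necessarily different, and let $\Delta>1$ be an integer. A walk from $s$ to $t$ is a finite sequence $v_1v_2\ldots v_n$ of vertices with $v_1=s$, $v_n=t$ such that, for each $i<n$, $v_iv_{i+1}$ is an edge of $G$ or $v_i=v_{i+1}$. Let $\mathcal M_\Delta(s,t)$ be the Markov chain whose states are all walks from $s$ to $t$ and whose transition probability from $P_1$ to $P_2$ is the probability that an agent $A'$ takes the walk $P_2$ when it pursues an agent $A$ taking the walk $P_1$ with delay $\Delta$. Here $A$ leaves $s$ at time $0$, follows $P_1$, taking one step of it per unit of time, and then stays at $t$ forever; $A'$ leaves $s$ at time $\Delta$, and in each unit of time it selects, uniformly at random and independently of its earlier selections, a shortest path in $G$ from its current vertex to the current location of $A$ and moves to the next vertex of that path (it stays in place if both are at the same vertex), until both agents have arrived and stopped at $t$. Let $\mathcal C$ be a closed communicating class of $\mathcal M_\Delta(s,t)$, i.e. a nonempty set of walks such that any two walks in $\mathcal C$ can be reached from each other, in finitely many steps with positive probability, and no walk outside $\mathcal C$ can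 be reached from $\mathcal C$. Then $\mathcal C$ is finite, and the limiting distribution of $\mathcal M_\Delta(s,t)$ restricted to $\mathcal C$ is the uniform distribution: for every initial distribution on $\mathcal C$ and every $P\in\mathcal C$, the probability that the chain is in the state $P$ after $n$ steps tends to $1/|\mathcal C|$ as $n\to\infty$. -/

import Mathlib

open Filter Topology
open scoped ENNReal

/-! ### Discrete-time Markov chains on an arbitrary (possibly infinite) state space -/

namespace MarkovChain

/-- A probability mass function that is carried by the set `S`, seen as one on the subtype `S`. -/
noncomputable def codRestrict {α : Type*} (p : PMF α) (S : Set α) (h : p.support ⊆ S) : PMF S :=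
  ⟨fun a => p a, by
    have h1 : ∑' a : S, p a = ∑' a, p a :=
      tsum_subtype_eq_of_support_subset (f := fun a => p a) h
    have h2 : ∑' a : S, p a = 1 := by rw [h1, p.tsum_coe]
    rw [← h2]
    exact ENNReal.summable.hasSum⟩

theorem codRestrict_apply {α : Type*} (p : PMF α) (S : Set α) (h : p.support ⊆ S) (a : S) :
    codRestrict p S h a = p a := rfl

/-- The law of the chain with transition kernel `κ` and initial law `μ` after `n` steps. -/
noncomputable def lawAfter {α : Type*} (κ : α → PMF α) (μ : PMF α) : ℕ → PMF α
  | 0 => μ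
  | n + 1 => (lawAfter κ μ n).bind κ

/-- The chain can go from `a` to `b` in finitely many steps with positive probability. -/
def CanReach {α : Type*} (κ : α → PMF α) (a b : α) : Prop :=
  ∃ n : ℕ, 0 < lawAfter κ (PMF.pure a) n b

/-- `C` is a closed communicating class: it is nonempty, any two of its states can be reached from
each other, and no state outside of `C` can be reached from `C`. -/
structure IsClosedClass {α : Type*} (κ : α → PMF α) (C : Set α) : Prop where
  nonempty : C.Nonempty
  communicates : ∀ a ∈ C, ∀ b ∈ C, CanReach κ a b
  closed : ∀ a ∈ C, ∀ b, CanReach κ a b → b ∈ C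

theorem IsClosedClass.support_subset {α : Type*} {κ : α → PMF α} {C : Set α}
    (hC : IsClosedClass κ C) {a : α} (ha : a ∈ C) : (κ a).support ⊆ C := by
  intro b hb
  refine hC.closed a ha b ⟨1, ?_⟩
  have h : lawAfter κ (PMF.pure a) 1 = κ a := by simp [lawAfter]
  rw [h]
  exact pos_iff_ne_zero.mpr ((PMF.mem_support_iff _ _).mp hb)

/-- The chain restricted to a closed communicating class: every state outside of `C` is deleted. -/
noncomputable def restrict {α : Type*} (κ : α → PMF α) (C : Set α) (hC : IsClosedClass κ C) :
    C → PMF C :=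
  fun a => codRestrict (κ a) C (hC.support_subset a.2)

/-- `π` is the limiting distribution of the chain `κ`: from every initial law `μ`, the probability
of being in the state `a` after `n` steps tends to `π a`. -/
def IsLimitingDistribution {α : Type*} (κ : α → PMF α) (π : PMF α) : Prop :=
  ∀ (μ : PMF α) (a : α), Tendsto (fun n => lawAfter κ μ n a) atTop (𝓝 (π a))

end MarkovChain

/-! ### Chain pursuit on a finite graph -/

namespace ChainPursuit

/-- `l` is the list of vertices of a walk from `s` to `t` in the reflexive closure of `G`
(every vertex carries a loop, so that a walk may stay in place). -/
def IsReflWalk {V : Type*} (G : SimpleGraph V) (s t : V) (l : List V) : Prop :=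
  l.IsChain (fun u v => G.Adj u v ∨ u = v) ∧ l.head? = some s ∧ l.getLast? = some t

/-- The walks from `s` to `t` (in the reflexive closure of `G`), as lists of vertices. -/
abbrev ReflWalk {V : Type*} (G : SimpleGraph V) (s t : V) : Type _ :=
  {l : List V // IsReflWalk G s t l}

/-- The number of time steps that the walk takes (one less than the number of its vertices). -/
def ReflWalk.duration {V : Type*} {G : SimpleGraph V} {s t : V} (P : ReflWalk G s t) : ℕ :=
  P.1.length - 1

/-- The position at time `τ` of an agent that starts the walk `P` at time `0`, takes one step per
unit of time and stays at `t` for ever after the end of the walk. -/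
def ReflWalk.pos {V : Type*} {G : SimpleGraph V} {s t : V} (P : ReflWalk G s t) (τ : ℕ) : V :=
  P.1.getD τ t

/-- The set of shortest paths of `G` from `x` to `y`. -/
def shortestPaths {V : Type*} (G : SimpleGraph V) (x y : V) : Set (G.Walk x y) :=
  {p | p.length = G.dist x y}

theorem shortestPaths_finite {V : Type*} [Finite V] (G : SimpleGraph V) (x y : V) :
    (shortestPaths G x y).Finite := by
  classical
  have := Fintype.ofFinite V
  exact Set.toFinite {p : G.Walk x y | p.length = G.dist x y}

theorem shortestPaths_nonempty {V : Type*} [Finite V] (G : SimpleGraph V) {x y : V}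
    (h : G.Reachable x y) : (shortestPaths_finite G x y).toFinset.Nonempty := by
  obtain ⟨p, hp⟩ := h.exists_walk_length_eq_dist
  exact ⟨p, by simpa [shortestPaths] using hp⟩

open Classical in
/-- The pursuit rule: an agent at `x` that pursues an agent at `y` selects uniformly at random a
shortest path from `x` to `y` and moves to the next vertex of that path. If `x = y`, the only
shortest path is the trivial one, whose `snd` is `x`, and the agent stays in place. (The value for
`y` unreachable from `x` is immaterial, since this never occurs in a pursuit.) -/
noncomputable def nextVertex {V : Type*} [Finite V] (G : SimpleGraph V) (x y : V) : PMF V :=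
  if h : G.Reachable x y then
    (PMF.uniformOfFinset (shortestPaths_finite G x y).toFinset
      (shortestPaths_nonempty G h)).map (fun p => p.snd)
  else PMF.pure x

/-- The law of the list of vertices that the pursuer visits from its local time `r` on, when it is
at `x` at that time; its local clock starts `Δ` units of time after that of the pursued agent, whose
position at time `τ` is `prey τ` and who arrives at `t` and stops at time `L`. At each unit of time
the pursuer applies the pursuit rule to the current location `prey (r + Δ)` of the pursued agent,
until both agents have arrived and stopped at `t`. The first argument bounds the number of
steps. -/
noncomputable def chase {V : Type*} [Finite V] [DecidableEq V] (G : SimpleGraph V) (Δ : ℕ) (t : V)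
    (prey : ℕ → V) (L : ℕ) : ℕ → ℕ → V → PMF (List V)
  | 0, _, x => PMF.pure [x]
  | n + 1, r, x =>
      if L ≤ r + Δ ∧ x = t then PMF.pure [x]
      else (nextVertex G x (prey (r + Δ))).bind fun y =>
        (chase G Δ t prey L n (r + 1) y).map (fun l => x :: l)

open Classical in
/-- The law of the list of vertices visited by an agent that leaves `s` with delay `Δ` after an
agent taking the walk `P` and pursues it. A pursuer always arrives at `t` within `P.duration` steps
(see `support_pursuitLaw`), so that the bound on the number of steps never interferes. -/
noncomputable def pursuitLaw {V : Type*} [Finite V] (G : SimpleGraph V) (Δ : ℕ) {s t : V}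
    (P : ReflWalk G s t) : PMF (List V) :=
  chase G Δ t P.pos P.duration P.duration 0 s

theorem nextVertex_support {V : Type*} [Finite V] (G : SimpleGraph V) {x z y : V}
    (p : G.Walk x z) (hy : y ∈ (nextVertex G x z).support) :
    (x = z ∧ y = x) ∨ (G.Adj x y ∧ ∃ q : G.Walk y z, q.length + 1 ≤ p.length) := by
  rw [nextVertex, dif_pos p.reachable, PMF.mem_support_map_iff] at hy
  obtain ⟨w, hw, rfl⟩ := hy
  have hw' : w.length = G.dist x z := by simpa [shortestPaths] using hw
  have hle : w.length ≤ p.length := hw' ▸ G.dist_le p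
  cases w with
  | nil => left; simp
  | cons h q =>
    right
    exact ⟨by simpa using h, q.copy (by simp) rfl, by
      rw [SimpleGraph.Walk.length_copy]; simpa using hle⟩

theorem ReflWalk.pos_zero {V : Type*} {G : SimpleGraph V} {s t : V} (P : ReflWalk G s t) :
    P.pos 0 = s := by
  obtain ⟨l, h1, h2, h3⟩ := P
  cases l with
  | nil => simp at h2
  | cons a l => simpa [ReflWalk.pos] using h2

theorem ReflWalk.pos_of_duration_le {V : Type*} {G : SimpleGraph V} {s t : V}
    (P : ReflWalk G s t) {τ : ℕ} (h : P.duration ≤ τ) : P.pos τ = t := by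
  obtain ⟨l, h1, h2, h3⟩ := P
  simp only [ReflWalk.duration, ReflWalk.pos] at *
  rw [List.getLast?_eq_getElem?] at h3
  rcases h.lt_or_eq with h | h
  · rw [List.getD_eq_default _ _ (by omega)]
  · rw [List.getD_eq_getElem?_getD, ← h, h3]; rfl

theorem ReflWalk.pos_succ {V : Type*} {G : SimpleGraph V} {s t : V} (P : ReflWalk G s t) (τ : ℕ) :
    G.Adj (P.pos τ) (P.pos (τ + 1)) ∨ P.pos τ = P.pos (τ + 1) := by
  by_cases h : P.duration ≤ τ
  · right
    rw [P.pos_of_duration_le h, P.pos_of_duration_le (by omega)]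
  · obtain ⟨l, h1, h2, h3⟩ := P
    simp only [ReflWalk.duration, ReflWalk.pos] at *
    rw [List.getD_eq_getElem _ _ (by omega), List.getD_eq_getElem _ _ (by omega)]
    exact List.isChain_iff_getElem.mp h1 τ (by omega)

theorem ReflWalk.exists_walk_pos {V : Type*} {G : SimpleGraph V} {s t : V} (P : ReflWalk G s t)
    (τ : ℕ) : ∃ w : G.Walk s (P.pos τ), w.length ≤ τ := by
  induction τ with
  | zero => exact ⟨SimpleGraph.Walk.nil.copy rfl P.pos_zero.symm, by simp⟩
  | succ τ ih =>
    obtain ⟨w, hw⟩ := ih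
    rcases P.pos_succ τ with h | h
    · exact ⟨w.concat h, by simpa using hw⟩
    · exact ⟨w.copy rfl h, by simp; omega⟩

theorem chase_support {V : Type*} [Finite V] [DecidableEq V] {G : SimpleGraph V} {Δ : ℕ}
    (hΔ : 1 < Δ) {s t : V} (P : ReflWalk G s t) (n r : ℕ) (x : V) (hn : n + r = P.duration)
    (hw : ∃ w : G.Walk x (P.pos (r + Δ)), w.length + (P.duration - (r + Δ)) ≤ n) (l : List V)
    (hl : l ∈ (chase G Δ t P.pos P.duration n r x).support) : IsReflWalk G x t l := by
  induction n generalizing r x l with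
  | zero =>
    obtain ⟨w, hw⟩ := hw
    have hx : x = t := by
      have h := SimpleGraph.Walk.eq_of_length_eq_zero (p := w) (by omega)
      rw [h, P.pos_of_duration_le (by omega)]
    simp only [chase, PMF.support_pure, Set.mem_singleton_iff] at hl
    subst hl
    simp [IsReflWalk, hx]
  | succ n ih =>
    obtain ⟨w, hw⟩ := hw
    rw [chase] at hl
    split_ifs at hl with hc
    · simp only [PMF.support_pure, Set.mem_singleton_iff] at hl
      subst hl
      simp [IsReflWalk, hc.2]
    · rw [PMF.mem_support_bind_iff] at hl
      obtain ⟨y, hy, hl⟩ := hl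
      rw [PMF.mem_support_map_iff] at hl
      obtain ⟨l, hl, rfl⟩ := hl
      have key : (G.Adj x y ∨ x = y) ∧ ∃ q : G.Walk y (P.pos (r + 1 + Δ)),
          q.length + (P.duration - (r + 1 + Δ)) ≤ n := by
        have hs := P.pos_succ (r + Δ)
        rw [show r + Δ + 1 = r + 1 + Δ by omega] at hs
        rcases nextVertex_support G w hy with ⟨h1, rfl⟩ | ⟨hadj, q, hq⟩
        · refine ⟨Or.inr rfl, ?_⟩
          have hlt : r + Δ < P.duration := by
            by_contra hge
            exact hc ⟨by omega, by rw [h1, P.pos_of_duration_le (by omega)]⟩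
          rcases hs with hs | hs
          · exact ⟨(SimpleGraph.Walk.cons hs .nil).copy h1.symm rfl, by simp; omega⟩
          · exact ⟨SimpleGraph.Walk.nil.copy rfl (h1.trans hs), by simp; omega⟩
        · refine ⟨Or.inl hadj, ?_⟩
          by_cases hlt : r + Δ < P.duration
          · rcases hs with hs | hs
            · exact ⟨q.concat hs, by simp; omega⟩
            · exact ⟨q.copy rfl hs, by simp; omega⟩
          · have e : P.pos (r + Δ) = P.pos (r + 1 + Δ) := by
              rw [P.pos_of_duration_le (by omega), P.pos_of_duration_le (by omega)]
            exact ⟨q.copy rfl e, by simp; omega⟩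
      obtain ⟨h1, h2, h3⟩ := ih (r + 1) y (by omega) key.2 l hl
      cases l with
      | nil => simp at h2
      | cons a l =>
        simp only [List.head?_cons, Option.some.injEq] at h2
        subst h2
        exact ⟨List.isChain_cons_cons.mpr ⟨key.1, h1⟩, by simp, by simpa using h3⟩

/-- The pursuer's walk is almost surely a walk from `s` to `t`. -/
theorem support_pursuitLaw {V : Type*} [Finite V] {G : SimpleGraph V} {Δ : ℕ} (hΔ : 1 < Δ) {s t : V}
    (P : ReflWalk G s t) : (pursuitLaw G Δ P).support ⊆ {l | IsReflWalk G s t l} := by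
  classical
  intro l hl
  refine chase_support hΔ P P.duration 0 s rfl ?_ l hl
  by_cases h : Δ ≤ P.duration
  · obtain ⟨w, hw⟩ := P.exists_walk_pos Δ
    exact ⟨w.copy rfl (by simp), by simp; omega⟩
  · obtain ⟨w, hw⟩ := P.exists_walk_pos P.duration
    have e : P.pos P.duration = P.pos (0 + Δ) := by
      rw [P.pos_of_duration_le le_rfl, P.pos_of_duration_le (by omega)]
    exact ⟨w.copy rfl e, by simp; omega⟩

/-- The Markov chain of chain pursuit with delay `Δ`, whose states are all the walks from `s` to
`t`: the transition law from `P` is the law of the walk taken by an agent that pursues an agent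
taking the walk `P`. -/
noncomputable def pursuitChain {V : Type*} [Finite V] (G : SimpleGraph V) (Δ : ℕ) (hΔ : 1 < Δ)
    (s t : V) : ReflWalk G s t → PMF (ReflWalk G s t) :=
  fun P => MarkovChain.codRestrict (pursuitLaw G Δ P) {l | IsReflWalk G s t l}
    (support_pursuitLaw hΔ P)

end ChainPursuit

/-! ### Markov chains: restriction to a closed class -/

namespace MarkovChain

/-! A pursuer never needs more time than its prey, so durations cannot increase along the chain and
are constant, say `L`, on a closed class; hence the class is finite. Within it no pursuer gains
time: the distance from pursuer to prey plus the time the prey still travels drops by exactly one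
per step (`chase_full_length`). Then following the prey's own footsteps is a possible pursuit
(`drop_mem_support_chase`), so every state has a self loop.

Let N(x, y) count the shortest paths. The transition probability from P to Q is a product of ratios
N(Q_{r+1}, P_{r+Δ}) / N(Q_r, P_{r+Δ}). Regrouping numerators and denominators turns it into the
probability that the reverse of Q is followed by the reverse of P (`prod_nextVertex_eq_reverse`).
For fixed Q, the sum over P is therefore at most the total mass of a reversed pursuit, namely 1
(`sum_pursuitLaw_le_one`). Column sums at most 1 make the uniform law stationary, and irreducibility
with self loops gives convergence by Doeblin contraction. -/

theorem map_val_codRestrict {α : Type*} (p : PMF α) (S : Set α) (h : p.support ⊆ S) :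
    (codRestrict p S h).map Subtype.val = p := by
  classical
  ext b
  rw [PMF.map_apply]
  by_cases hb : b ∈ S
  · rw [tsum_eq_single (⟨b, hb⟩ : S)]
    · simp [codRestrict_apply]
    · intro a ha
      rw [if_neg]
      rintro rfl
      exact ha rfl
  · have h0 : p b = 0 := by
      by_contra h1
      exact hb (h ((PMF.mem_support_iff _ _).mpr h1))
    rw [h0, ENNReal.tsum_eq_zero]
    intro a
    rw [if_neg]
    rintro rfl
    exact hb a.2

theorem map_val_lawAfter_restrict {α : Type*} (κ : α → PMF α) (C : Set α)
    (hC : IsClosedClass κ C) (μ : PMF C) (n : ℕ) :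
    (lawAfter (restrict κ C hC) μ n).map Subtype.val = lawAfter κ (μ.map Subtype.val) n := by
  induction n with
  | zero => rfl
  | succ n ih =>
    rw [lawAfter, lawAfter, ← ih, PMF.map_bind, PMF.bind_map]
    congr 1
    funext a
    exact map_val_codRestrict _ _ _

theorem map_val_apply {α : Type*} {S : Set α} (p : PMF S) (a : S) :
    p.map Subtype.val (a : α) = p a := by
  classical
  rw [PMF.map_apply, tsum_eq_single a]
  · simp
  · intro b hb
    rw [if_neg]
    exact fun h => hb (Subtype.ext h.symm)

theorem canReach_restrict {α : Type*} {κ : α → PMF α} {C : Set α} (hC : IsClosedClass κ C)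
    (a b : C) : CanReach (restrict κ C hC) a b := by
  obtain ⟨n, hn⟩ := hC.communicates a a.2 b b.2
  refine ⟨n, ?_⟩
  rw [← map_val_apply, map_val_lawAfter_restrict, PMF.pure_map]
  exact hn

/-! ### Convergence of finite irreducible chains with self loops -/

theorem lawAfter_eq_bind {α : Type*} (κ : α → PMF α) (μ : PMF α) (n : ℕ) :
    lawAfter κ μ n = μ.bind fun a => lawAfter κ (PMF.pure a) n := by
  induction n with
  | zero => simp [lawAfter]
  | succ n ih => simp only [lawAfter]; rw [ih, PMF.bind_bind]

theorem lawAfter_add {α : Type*} (κ : α → PMF α) (μ : PMF α) (m n : ℕ) :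
    lawAfter κ μ (m + n) = lawAfter κ (lawAfter κ μ m) n := by
  induction n with
  | zero => rfl
  | succ n ih => rw [← add_assoc, lawAfter, ih, lawAfter]

/-- With self loops everywhere, the set of reachable states grows with the number of steps. -/
theorem lawAfter_ne_zero_of_le {α : Type*} {κ : α → PMF α} (hself : ∀ a, κ a a ≠ 0) {μ : PMF α}
    {b : α} {m n : ℕ} (hmn : m ≤ n) (h : lawAfter κ μ m b ≠ 0) : lawAfter κ μ n b ≠ 0 := by
  induction n, hmn using Nat.le_induction with
  | base => exact h
  | succ n _ ih =>
    rw [lawAfter, ← PMF.mem_support_iff, PMF.mem_support_bind_iff]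
    exact ⟨b, (PMF.mem_support_iff _ _).mpr ih, (PMF.mem_support_iff _ _).mpr (hself b)⟩

/-- Finitely many pairs need boundedly many steps, and self loops let the faster ones wait. -/
theorem exists_forall_lawAfter_ne_zero {α : Type*} [Finite α] {κ : α → PMF α}
    (hirr : ∀ a b, CanReach κ a b) (hself : ∀ a, κ a a ≠ 0) :
    ∃ N, ∀ a b, lawAfter κ (PMF.pure a) N b ≠ 0 := by
  choose n hn using hirr
  obtain ⟨N, hN⟩ := (Set.finite_range (fun p : α × α => n p.1 p.2)).bddAbove
  exact ⟨N, fun a b => lawAfter_ne_zero_of_le hself (hN ⟨(a, b), rfl⟩) (hn a b).ne'⟩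

/-- The `ℓ¹` distance of two probability mass functions on a finite type. -/
noncomputable def l1Dist {α : Type*} [Fintype α] (p q : PMF α) : ℝ :=
  ∑ a, |(p a).toReal - (q a).toReal|

theorem sum_toReal {α : Type*} [Fintype α] (p : PMF α) : ∑ a, (p a).toReal = 1 := by
  rw [← ENNReal.toReal_sum fun a _ => p.apply_ne_top a, ← tsum_fintype (L := .unconditional _),
    p.tsum_coe, ENNReal.toReal_one]

theorem bind_apply_toReal {α β : Type*} [Fintype α] (p : PMF α) (Q : α → PMF β) (b : β) :
    (p.bind Q b).toReal = ∑ a, (p a).toReal * (Q a b).toReal := by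
  rw [PMF.bind_apply, tsum_fintype, ENNReal.toReal_sum]
  · simp [ENNReal.toReal_mul]
  · exact fun a _ => ENNReal.mul_ne_top (p.apply_ne_top a) ((Q a).apply_ne_top b)

/-- Doeblin contraction. -/
theorem l1Dist_bind_le {α : Type*} [Fintype α] (p q : PMF α) (Q : α → PMF α) {ε : ℝ}
    (hQ : ∀ a b, ε ≤ (Q a b).toReal) :
    l1Dist (p.bind Q) (q.bind Q) ≤ (1 - ε * Fintype.card α) * l1Dist p q := by
  have h0 : ∑ a, ((p a).toReal - (q a).toReal) = 0 := by
    rw [Finset.sum_sub_distrib, sum_toReal, sum_toReal, sub_self]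
  have h1 : ∀ b, |(p.bind Q b).toReal - (q.bind Q b).toReal| ≤
      ∑ a, |(p a).toReal - (q a).toReal| * ((Q a b).toReal - ε) := by
    intro b
    -- The differences of `p` and `q` sum to zero, so `ε` can be subtracted from every entry of `Q`
    -- at no cost; the entries stay nonnegative and each row sum falls to `1 - ε * card α`.
    have h2 : (p.bind Q b).toReal - (q.bind Q b).toReal =
        ∑ a, ((p a).toReal - (q a).toReal) * ((Q a b).toReal - ε) := by
      simp only [mul_sub, Finset.sum_sub_distrib, ← Finset.sum_mul, h0]
      rw [bind_apply_toReal, bind_apply_toReal, ← Finset.sum_sub_distrib]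
      simp [sub_mul]
    rw [h2]
    refine (Finset.abs_sum_le_sum_abs _ _).trans (Finset.sum_le_sum fun a _ => ?_)
    rw [abs_mul, abs_of_nonneg (sub_nonneg.mpr (hQ a b))]
  refine (Finset.sum_le_sum fun b _ => h1 b).trans (le_of_eq ?_)
  rw [Finset.sum_comm, l1Dist, Finset.mul_sum]
  refine Finset.sum_congr rfl fun a _ => ?_
  rw [← Finset.mul_sum, Finset.sum_sub_distrib, sum_toReal]
  simp [mul_comm]

/-- The contraction with `ε = 0`; it extends decay along multiples of `N` to all times. -/
theorem l1Dist_lawAfter_antitone {α : Type*} [Fintype α] (κ : α → PMF α) (p q : PMF α) :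
    Antitone fun n => l1Dist (lawAfter κ p n) (lawAfter κ q n) := by
  refine antitone_nat_of_succ_le fun n => ?_
  simpa [lawAfter] using l1Dist_bind_le (lawAfter κ p n) (lawAfter κ q n) κ (ε := 0)
    fun a b => ENNReal.toReal_nonneg

theorem tendsto_l1Dist_lawAfter {α : Type*} [Fintype α] [Nonempty α] {κ : α → PMF α}
    (hirr : ∀ a b, CanReach κ a b) (hself : ∀ a, κ a a ≠ 0) (p q : PMF α) :
    Tendsto (fun n => l1Dist (lawAfter κ p n) (lawAfter κ q n)) atTop (𝓝 0) := by
  obtain ⟨N, hN⟩ := exists_forall_lawAfter_ne_zero hirr hself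
  obtain ⟨⟨a₀, b₀⟩, hmin⟩ := Finite.exists_min
    fun c : α × α => (lawAfter κ (PMF.pure c.1) N c.2).toReal
  set ε := (lawAfter κ (PMF.pure a₀) N b₀).toReal with hε
  have hpos : 0 < ε := ENNReal.toReal_pos (hN _ _) (PMF.apply_ne_top _ _)
  have hstep : ∀ p q, l1Dist (lawAfter κ p N) (lawAfter κ q N) ≤
      (1 - ε * Fintype.card α) * l1Dist p q := by
    intro p q
    rw [lawAfter_eq_bind κ p, lawAfter_eq_bind κ q]
    exact l1Dist_bind_le _ _ _ fun a b => hmin (a, b)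
  have hc0 : 0 ≤ 1 - ε * Fintype.card α := by
    rw [← sum_toReal (lawAfter κ (PMF.pure a₀) N), sub_nonneg, mul_comm, ← nsmul_eq_mul]
    exact Finset.card_nsmul_le_sum _ _ _ fun b _ => hmin (a₀, b)
  have hc1 : 1 - ε * Fintype.card α < 1 := by
    have : (0 : ℝ) < Fintype.card α := by exact_mod_cast Fintype.card_pos
    nlinarith [mul_pos hpos this]
  have hgeom : ∀ k, l1Dist (lawAfter κ p (k * N)) (lawAfter κ q (k * N)) ≤
      (1 - ε * Fintype.card α) ^ k * l1Dist p q := by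
    intro k
    induction k with
    | zero => simp [lawAfter]
    | succ k ih =>
      rw [Nat.succ_mul, lawAfter_add, lawAfter_add, pow_succ', mul_assoc]
      exact (hstep _ _).trans (mul_le_mul_of_nonneg_left ih hc0)
  have hnonneg : ∀ n, 0 ≤ l1Dist (lawAfter κ p n) (lawAfter κ q n) :=
    fun n => Finset.sum_nonneg fun _ _ => abs_nonneg _
  rw [Metric.tendsto_atTop]
  intro δ hδ
  have hlim : Tendsto (fun k => (1 - ε * Fintype.card α) ^ k * l1Dist p q) atTop (𝓝 0) := by
    simpa using (tendsto_pow_atTop_nhds_zero_of_lt_one hc0 hc1).mul_const (l1Dist p q)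
  obtain ⟨k, hk⟩ := (hlim.eventually_lt_const hδ).exists
  refine ⟨k * N, fun n hn => ?_⟩
  rw [Real.dist_eq, sub_zero, abs_of_nonneg (hnonneg n)]
  exact (l1Dist_lawAfter_antitone κ p q hn).trans_lt ((hgeom k).trans_lt hk)

/-- An irreducible finite chain with self loops converges to any stationary law. -/
theorem isLimitingDistribution_of_stationary {α : Type*} [Fintype α] [Nonempty α] {κ : α → PMF α}
    (hirr : ∀ a b, CanReach κ a b) (hself : ∀ a, κ a a ≠ 0) {π : PMF α} (hπ : π.bind κ = π) :
    IsLimitingDistribution κ π := by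
  intro μ a
  have hstat : ∀ n, lawAfter κ π n = π := by
    intro n
    induction n with
    | zero => rfl
    | succ n ih => rw [lawAfter, ih, hπ]
  have h := tendsto_l1Dist_lawAfter hirr hself μ π
  simp only [hstat] at h
  rw [← ENNReal.tendsto_toReal_iff (fun n => PMF.apply_ne_top _ _) (PMF.apply_ne_top _ _)]
  rw [tendsto_iff_dist_tendsto_zero]
  refine squeeze_zero (fun _ => dist_nonneg) (fun n => ?_) h
  rw [Real.dist_eq]
  exact Finset.single_le_sum (f := fun a => |(lawAfter κ μ n a).toReal - (π a).toReal|)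
    (fun _ _ => abs_nonneg _) (Finset.mem_univ a)

/-- One inequality suffices: both laws have mass 1, so a strict inequality at one point would lose
mass. -/
theorem uniformOfFintype_bind_eq {α : Type*} [Fintype α] [Nonempty α] {κ : α → PMF α}
    (hcol : ∀ b, ∑ a, κ a b ≤ 1) :
    (PMF.uniformOfFintype α).bind κ = PMF.uniformOfFintype α := by
  have hle : ∀ b, (PMF.uniformOfFintype α).bind κ b ≤ PMF.uniformOfFintype α b := by
    intro b
    simp only [PMF.bind_apply, PMF.uniformOfFintype_apply, tsum_fintype, ← Finset.mul_sum]
    exact mul_le_of_le_one_right' (hcol b)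
  ext b
  refine le_antisymm (hle b) ?_
  by_contra! hlt
  have h := ENNReal.tsum_lt_tsum (i := b) (PMF.tsum_coe_ne_top _) hle hlt
  rw [PMF.tsum_coe, PMF.tsum_coe] at h
  exact lt_irrefl _ h

end MarkovChain

namespace ChainPursuit

open scoped NNReal

/-! ### Counting shortest paths -/

section Counting

variable {V : Type*} (G : SimpleGraph V)

/-- The number of shortest paths from `x` to `y`. -/
noncomputable def numShortest (x y : V) : ℕ := (shortestPaths G x y).ncard

/-- This symmetry lets a pursuit and its time reversal share the same counts. -/
theorem numShortest_comm (x y : V) : numShortest G x y = numShortest G y x := by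
  refine Set.ncard_congr (fun p _ => p.reverse) (fun p hp => ?_)
    (fun p q _ _ h => SimpleGraph.Walk.reverse_injective h)
    (fun p hp => ⟨p.reverse, ?_, p.reverse_reverse⟩)
  · simpa [shortestPaths, G.dist_comm (u := y)] using hp
  · simpa [shortestPaths, G.dist_comm (u := x)] using hp

theorem numShortest_self (x : V) : numShortest G x x = 1 := by
  rw [numShortest, Set.ncard_eq_one]
  refine ⟨SimpleGraph.Walk.nil, Set.eq_singleton_iff_unique_mem.mpr ⟨by simp [shortestPaths], ?_⟩⟩
  intro p hp
  have hp' : p.length = 0 := by simpa [shortestPaths] using hp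
  cases p with
  | nil => rfl
  | cons h q => simp at hp'

variable [Finite V]

theorem numShortest_ne_zero {x y : V} (h : G.Reachable x y) : numShortest G x y ≠ 0 := by
  obtain ⟨p, hp⟩ := h.exists_walk_length_eq_dist
  exact Set.ncard_ne_zero_of_mem (a := p) hp (shortestPaths_finite G x y)

/-- Prepending the edge from `x` to `y` matches the shortest paths from `y` to `z` with those from
`x` to `z` whose second vertex is `y`. -/
theorem nextVertex_apply {x y z : V} (hadj : G.Adj x y) (hyz : G.Reachable y z)
    (hd : G.dist y z + 1 = G.dist x z) :
    nextVertex G x z y = ((numShortest G y z / numShortest G x z : ℝ≥0) : ℝ≥0∞) := by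
  classical
  have hxz : G.Reachable x z := hadj.reachable.trans hyz
  rw [nextVertex, dif_pos hxz, ← PMF.toOuterMeasure_apply_singleton,
    PMF.toOuterMeasure_map_apply, PMF.toOuterMeasure_uniformOfFinset_apply,
    ENNReal.coe_div (by exact_mod_cast numShortest_ne_zero G hxz)]
  congr 1
  · norm_cast
    rw [← Set.ncard_coe_finset]
    symm
    refine Set.ncard_congr (fun p _ => SimpleGraph.Walk.cons hadj p) (fun p hp => ?_)
      (fun p q _ _ h => by simpa using h) (fun w hw => ?_)
    · have hp' : p.length = G.dist y z := hp
      simp [shortestPaths, hp', hd]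
    · have hw' : w.length = G.dist x z ∧ w.snd = y := by simpa [shortestPaths] using hw
      cases w with
      | nil => simp at hd
      | cons h q =>
        obtain ⟨h1, h2⟩ := hw'
        simp only [SimpleGraph.Walk.snd_cons] at h2
        subst h2
        refine ⟨q, ?_, rfl⟩
        simp only [SimpleGraph.Walk.length_cons] at h1
        change q.length = _
        omega
  · norm_cast
    rw [numShortest, Set.ncard_eq_toFinset_card _ (shortestPaths_finite G x z)]

theorem nextVertex_ne_zero {x y z : V} (hadj : G.Adj x y) (hyz : G.Reachable y z)
    (hd : G.dist y z + 1 = G.dist x z) : nextVertex G x z y ≠ 0 := by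
  rw [nextVertex_apply G hadj hyz hd]
  have h1 := numShortest_ne_zero G hyz
  have h2 := numShortest_ne_zero G (hadj.reachable.trans hyz)
  simp [h1, h2]

/-- Time reversal: if `u` pursues `v` with delay `Δ` without ever gaining on it, then the
probability of `u` given `v` is that of the reverse of `v` given the reverse of `u`. -/
theorem prod_nextVertex_eq_reverse (Δ L : ℕ) (u v : ℕ → V) (hreach : ∀ i j, G.Reachable (u i) (v j))
    (h0 : u 0 = v 0) (hend : ∀ j, L ≤ j → v j = u L)
    (hf : ∀ r < L, G.Adj (u r) (u (r + 1)) ∧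
      G.dist (u (r + 1)) (v (r + Δ)) + 1 = G.dist (u r) (v (r + Δ)))
    (hb : ∀ j < L, G.Adj (v (j + 1)) (v j) ∧
      G.dist (v j) (u (j + 1 - Δ)) + 1 = G.dist (v (j + 1)) (u (j + 1 - Δ))) :
    ∏ r ∈ Finset.range L, nextVertex G (u r) (v (r + Δ)) (u (r + 1)) =
      ∏ j ∈ Finset.range L, nextVertex G (v (j + 1)) (u (j + 1 - Δ)) (v j) := by
  -- On the clock of `v`, truncated subtraction keeps the pursuer at `u 0` until time `Δ`. Forward
  -- factors are `b j / a j`, backward ones `b j / a (j + 1)`.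
  set a : ℕ → ℝ≥0 := fun j => numShortest G (u (j - Δ)) (v j) with ha
  set b : ℕ → ℝ≥0 := fun j => numShortest G (u (j + 1 - Δ)) (v j) with hbdef
  have ha0 : ∀ j, a j ≠ 0 := fun j => by
    simp only [ha]
    exact_mod_cast numShortest_ne_zero G (hreach _ _)
  have hF : ∀ r ∈ Finset.range L, nextVertex G (u r) (v (r + Δ)) (u (r + 1)) =
      ((b (Δ + r) / a (Δ + r) : ℝ≥0) : ℝ≥0∞) := by
    intro r hr
    obtain ⟨h1, h2⟩ := hf r (Finset.mem_range.mp hr)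
    rw [nextVertex_apply G h1 (hreach _ _) h2]
    simp only [ha, hbdef, add_comm Δ r, show r + Δ - Δ = r by omega,
      show r + Δ + 1 - Δ = r + 1 by omega]
  have hB : ∀ j ∈ Finset.range L, nextVertex G (v (j + 1)) (u (j + 1 - Δ)) (v j) =
      ((b j / a (j + 1) : ℝ≥0) : ℝ≥0∞) := by
    intro j hj
    obtain ⟨h1, h2⟩ := hb j (Finset.mem_range.mp hj)
    rw [nextVertex_apply G h1 (hreach _ _).symm h2, numShortest_comm G (v j),
      numShortest_comm G (v (j + 1))]
  rw [Finset.prod_congr rfl hF, Finset.prod_congr rfl hB]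
  norm_cast
  -- Both products extend to `L + Δ` factors: the new forward ones are 1 because `u` has not left,
  -- the new backward ones because `v` has stopped.
  have hfirst : ∏ j ∈ Finset.range (Δ + L), b j / a j =
      ∏ r ∈ Finset.range L, b (Δ + r) / a (Δ + r) := by
    rw [Finset.prod_range_add, Finset.prod_eq_one, one_mul]
    intro j hj
    have : b j = a j := by
      have := Finset.mem_range.mp hj
      simp only [ha, hbdef, show j + 1 - Δ = 0 by omega, show j - Δ = 0 by omega]
    rw [this, div_self (ha0 j)]
  have hlast : ∏ j ∈ Finset.range (L + Δ), b j / a (j + 1) =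
      ∏ j ∈ Finset.range L, b j / a (j + 1) := by
    rw [Finset.prod_range_add, Finset.prod_eq_one (s := Finset.range Δ), mul_one]
    intro j _
    have : b (L + j) = a (L + j + 1) := by
      simp only [ha, hbdef, hend (L + j) (by omega), hend (L + j + 1) (by omega)]
    rw [this, div_self (ha0 _)]
  -- The two agents coincide at both ends, so the boundary terms `a 0` and `a (L + Δ)` are 1.
  have hshift : ∏ j ∈ Finset.range (L + Δ), a j = ∏ j ∈ Finset.range (L + Δ), a (j + 1) := by
    have e1 : a 0 = 1 := by simp [ha, h0, numShortest_self]
    have e2 : a (L + Δ) = 1 := by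
      simp [ha, hend (L + Δ) (by omega), numShortest_self]
    have h := (Finset.prod_range_succ' a (L + Δ)).symm.trans (Finset.prod_range_succ a (L + Δ))
    rw [e1, e2, mul_one, mul_one] at h
    exact h.symm
  rw [← hfirst, ← hlast, add_comm Δ L, Finset.prod_div_distrib, Finset.prod_div_distrib, hshift]

end Counting

/-- The total weight of the trajectories of a time-dependent Markov chain from a given point. -/
theorem sum_prod_kernel {V : Type*} [Fintype V] [DecidableEq V] (k : ℕ → V → PMF V) (x : V)
    (n : ℕ) :
    ∑ w : Fin (n + 1) → V,
      (if w 0 = x then ∏ i : Fin n, k i (w i.castSucc) (w i.succ) else 0) = 1 := by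
  induction n with
  | zero =>
    rw [← (Equiv.funUnique (Fin 1) V).symm.sum_comp]
    simp
  | succ n ih =>
    rw [← (Fin.snocEquiv fun _ => V).sum_comp, Fintype.sum_prod_type_right, ← ih]
    refine Finset.sum_congr rfl fun w _ => ?_
    have h : ∀ y : V, (if (Fin.snocEquiv (fun _ : Fin (n + 2) => V) (y, w)) 0 = x then
        ∏ i : Fin (n + 1), k i (Fin.snocEquiv (fun _ : Fin (n + 2) => V) (y, w) i.castSucc)
          (Fin.snocEquiv (fun _ : Fin (n + 2) => V) (y, w) i.succ) else 0) =
        (if w 0 = x then ∏ i : Fin n, k i (w i.castSucc) (w i.succ) else 0) *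
          k n (w (Fin.last n)) y := by
      intro y
      have e0 : (Fin.snocEquiv (fun _ : Fin (n + 2) => V) (y, w)) 0 = w 0 :=
        Fin.snoc_castSucc (α := fun _ : Fin (n + 2) => V) y w 0
      rw [e0, Fin.prod_univ_castSucc, ite_mul, zero_mul]
      simp [Fin.snocEquiv, ← Fin.castSucc_succ]
    rw [Finset.sum_congr rfl fun y _ => h y, ← Finset.mul_sum,
      ← tsum_fintype (L := .unconditional _), PMF.tsum_coe, mul_one]

/-! ### Pursuits that never gain on their prey -/

section Pursuit

variable {V : Type*} {G : SimpleGraph V} {s t : V}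

theorem ReflWalk.length_eq (P : ReflWalk G s t) : P.1.length = P.duration + 1 := by
  obtain ⟨l, h1, h2, h3⟩ := P
  cases l with
  | nil => simp at h2
  | cons a l => simp [ReflWalk.duration]

theorem ReflWalk.exists_walk_pos_add (P : ReflWalk G s t) (i k : ℕ) :
    ∃ w : G.Walk (P.pos i) (P.pos (i + k)), w.length ≤ min k (P.duration - i) := by
  induction k with
  | zero => exact ⟨.nil, by simp⟩
  | succ k ih =>
    obtain ⟨w, hw⟩ := ih
    by_cases h : P.duration ≤ i + k
    · have e : P.pos (i + k) = P.pos (i + (k + 1)) := by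
        rw [P.pos_of_duration_le h, P.pos_of_duration_le (by omega)]
      exact ⟨w.copy rfl e, by simp only [SimpleGraph.Walk.length_copy]; omega⟩
    · rcases P.pos_succ (i + k) with h' | h'
      · exact ⟨w.concat h', by simp only [SimpleGraph.Walk.length_concat]; omega⟩
      · exact ⟨w.copy rfl h', by simp only [SimpleGraph.Walk.length_copy]; omega⟩

theorem ReflWalk.reachable_pos (P : ReflWalk G s t) (i : ℕ) : G.Reachable s (P.pos i) :=
  ⟨(P.exists_walk_pos i).choose⟩

theorem exists_walk_start {Δ : ℕ} (P : ReflWalk G s t) :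
    ∃ w : G.Walk s (P.pos (0 + Δ)), w.length + (P.duration - (0 + Δ)) ≤ P.duration := by
  obtain ⟨w, hw⟩ := P.exists_walk_pos_add 0 Δ
  exact ⟨w.copy P.pos_zero rfl, by rw [SimpleGraph.Walk.length_copy]; omega⟩

theorem ReflWalk.ext_pos {P Q : ReflWalk G s t} (hdur : P.duration = Q.duration)
    (h : ∀ i ≤ P.duration, P.pos i = Q.pos i) : P = Q := by
  have hP := P.length_eq
  have hQ := Q.length_eq
  refine Subtype.ext (List.ext_getElem (by omega) fun i h1 h2 => ?_)
  have := h i (by omega)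
  rwa [ReflWalk.pos, ReflWalk.pos, List.getD_eq_getElem _ _ h1, List.getD_eq_getElem _ _ h2] at this

variable [Finite V]

/-- One step of the pursuit, as long as the pursuer has not stopped. -/
theorem pursuit_step {Δ : ℕ} (P : ReflWalk G s t) {m r : ℕ} {x y : V}
    (hc : ¬(P.duration ≤ r + Δ ∧ x = t))
    (hm : r + Δ < P.duration → P.duration - (r + Δ) + 1 ≤ m)
    (hw : ∃ w : G.Walk x (P.pos (r + Δ)), w.length + (P.duration - (r + Δ)) ≤ m)
    (hy : y ∈ (nextVertex G x (P.pos (r + Δ))).support) :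
    ∃ m', m = m' + 1 ∧ (r + 1 + Δ < P.duration → P.duration - (r + 1 + Δ) + 1 ≤ m') ∧
      ∃ q : G.Walk y (P.pos (r + 1 + Δ)), q.length + (P.duration - (r + 1 + Δ)) ≤ m' := by
  obtain ⟨w, hw⟩ := hw
  have hs := P.pos_succ (r + Δ)
  rw [show r + Δ + 1 = r + 1 + Δ by omega] at hs
  rcases nextVertex_support G w hy with ⟨h1, rfl⟩ | ⟨hadj, q, hq⟩
  · have hlt : r + Δ < P.duration := by
      by_contra hge
      exact hc ⟨by omega, by rw [h1, P.pos_of_duration_le (by omega)]⟩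
    -- A pursuer that has caught up waits while the prey may step away, so distance plus remaining
    -- time need not drop; the spare unit in `hm` pays for this.
    refine ⟨m - 1, by omega, by omega, ?_⟩
    rcases hs with hs | hs
    · exact ⟨(SimpleGraph.Walk.cons hs .nil).copy h1.symm rfl, by simp; omega⟩
    · exact ⟨SimpleGraph.Walk.nil.copy rfl (h1.trans hs), by simp; omega⟩
  · refine ⟨m - 1, by omega, by omega, ?_⟩
    by_cases hlt : r + Δ < P.duration
    · rcases hs with hs | hs
      · exact ⟨q.concat hs, by simp; omega⟩
      · exact ⟨q.copy rfl hs, by simp; omega⟩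
    · have e : P.pos (r + Δ) = P.pos (r + 1 + Δ) := by
        rw [P.pos_of_duration_le (by omega), P.pos_of_duration_le (by omega)]
      exact ⟨q.copy rfl e, by simp; omega⟩

variable [DecidableEq V]

/-- The budget `m` is independent of the cutoff `n`: taking it smaller shows that time once gained
is never lost. -/
theorem chase_length_le {Δ : ℕ} (P : ReflWalk G s t) (n m r : ℕ) (x : V)
    (hm : r + Δ < P.duration → P.duration - (r + Δ) + 1 ≤ m)
    (hw : ∃ w : G.Walk x (P.pos (r + Δ)), w.length + (P.duration - (r + Δ)) ≤ m) (l : List V)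
    (hl : l ∈ (chase G Δ t P.pos P.duration n r x).support) : l.length ≤ m + 1 := by
  induction n generalizing m r x l with
  | zero =>
    simp only [chase, PMF.support_pure, Set.mem_singleton_iff] at hl
    simp [hl]
  | succ n ih =>
    rw [chase] at hl
    split_ifs at hl with hc
    · simp only [PMF.support_pure, Set.mem_singleton_iff] at hl
      simp [hl]
    · rw [PMF.mem_support_bind_iff] at hl
      obtain ⟨y, hy, hl⟩ := hl
      rw [PMF.mem_support_map_iff] at hl
      obtain ⟨l, hl, rfl⟩ := hl
      obtain ⟨m', rfl, hm', hq⟩ := pursuit_step P hc hm hw hy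
      simpa using ih m' (r + 1) y hm' hq l hl

theorem le_dist_of_length_eq {Δ : ℕ} (hΔ : 1 < Δ) (P : ReflWalk G s t) {n r : ℕ}
    (hn : n + r = P.duration) {x : V} (hx : G.Reachable x (P.pos (r + Δ))) {l : List V}
    (hl : l ∈ (chase G Δ t P.pos P.duration n r x).support) (hlen : l.length = n + 1) :
    n ≤ G.dist x (P.pos (r + Δ)) + (P.duration - (r + Δ)) := by
  by_contra! h
  obtain ⟨w, hw⟩ := hx.exists_walk_length_eq_dist
  -- The spare unit required of the budget `n - 1` is available because `Δ ≥ 2`.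
  have := chase_length_le P n (n - 1) r x (by omega) ⟨w, by omega⟩ l hl
  omega

theorem head_of_mem_support_chase {Δ : ℕ} {prey : ℕ → V} {L n r : ℕ} {x : V} {l : List V}
    (hl : l ∈ (chase G Δ t prey L n r x).support) : ∃ l', l = x :: l' := by
  cases n with
  | zero =>
    simp only [chase, PMF.support_pure, Set.mem_singleton_iff] at hl
    exact ⟨[], hl⟩
  | succ n =>
    rw [chase] at hl
    split_ifs at hl with hc
    · simp only [PMF.support_pure, Set.mem_singleton_iff] at hl
      exact ⟨[], hl⟩
    · rw [PMF.mem_support_bind_iff] at hl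
      obtain ⟨y, hy, hl⟩ := hl
      rw [PMF.mem_support_map_iff] at hl
      obtain ⟨l, hl, rfl⟩ := hl
      exact ⟨l, rfl⟩

/-- A pursuit that uses up all its steps never gains on its prey. -/
theorem chase_full_length {Δ : ℕ} (hΔ : 1 < Δ) (P : ReflWalk G s t) (n r : ℕ)
    (hn : n + r = P.duration) (x : V)
    (hw : ∃ w : G.Walk x (P.pos (r + Δ)), w.length + (P.duration - (r + Δ)) ≤ n) (l : List V)
    (hl : l ∈ (chase G Δ t P.pos P.duration n r x).support) (hlen : l.length = n + 1) :
    (∀ i ≤ n, G.dist (l.getD i t) (P.pos (r + i + Δ)) + (P.duration - (r + i + Δ)) = n - i) ∧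
      ∀ i < n, l.getD (i + 1) t ∈ (nextVertex G (l.getD i t) (P.pos (r + i + Δ))).support := by
  -- `hw` bounds the sum above; the full length of `l` bounds it below.
  have hbase : G.dist x (P.pos (r + Δ)) + (P.duration - (r + Δ)) = n := by
    obtain ⟨w, hw⟩ := hw
    have h1 := G.dist_le w
    have h2 := le_dist_of_length_eq hΔ P hn w.reachable hl hlen
    omega
  induction n generalizing r x l with
  | zero =>
    obtain ⟨l', rfl⟩ := head_of_mem_support_chase hl
    refine ⟨fun i hi => ?_, fun i hi => absurd hi (Nat.not_lt_zero i)⟩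
    obtain rfl : i = 0 := by omega
    simpa using hbase
  | succ n ih =>
    rw [chase] at hl
    split_ifs at hl with hc
    · simp only [PMF.support_pure, Set.mem_singleton_iff] at hl
      simp [hl] at hlen
    · rw [PMF.mem_support_bind_iff] at hl
      obtain ⟨y, hy, hl⟩ := hl
      rw [PMF.mem_support_map_iff] at hl
      obtain ⟨l, hl, rfl⟩ := hl
      obtain ⟨m', hm, -, hq⟩ := pursuit_step P hc (by omega) hw hy
      obtain rfl : n = m' := by omega
      simp only [List.length_cons, Nat.add_right_cancel_iff] at hlen
      have hbase' : G.dist y (P.pos (r + 1 + Δ)) + (P.duration - (r + 1 + Δ)) = n := by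
        obtain ⟨q, hq⟩ := hq
        have h1 := G.dist_le q
        have h2 := le_dist_of_length_eq hΔ P (by omega) q.reachable hl hlen
        omega
      obtain ⟨ih1, ih2⟩ := ih (r + 1) (by omega) y hq l hl hlen hbase'
      constructor
      · intro i hi
        cases i with
        | zero => simpa using hbase
        | succ i =>
          have := ih1 i (by omega)
          rw [show r + 1 + i = r + (i + 1) by omega] at this
          simpa using this
      · intro i hi
        cases i with
        | zero =>
          obtain ⟨l', rfl⟩ := head_of_mem_support_chase hl
          simpa using hy
        | succ i =>
          have := ih2 i (by omega)
          rw [show r + 1 + i = r + (i + 1) by omega] at this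
          simpa using this

/-- An upper bound is all that the column sums need, and it holds trivially for lists outside the
support. -/
theorem chase_apply_le {Δ : ℕ} {prey : ℕ → V} {L : ℕ} (n r : ℕ) (x : V) (l : List V)
    (hlen : l.length = n + 1) :
    chase G Δ t prey L n r x l ≤
      ∏ i ∈ Finset.range n, nextVertex G (l.getD i t) (prey (r + i + Δ)) (l.getD (i + 1) t) := by
  induction n generalizing r x l with
  | zero => simp [PMF.coe_le_one]
  | succ n ih =>
    by_cases hl : l ∈ (chase G Δ t prey L (n + 1) r x).support
    swap
    · rw [PMF.mem_support_iff, not_not] at hl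
      simp [hl]
    obtain ⟨l, rfl⟩ := head_of_mem_support_chase hl
    simp only [List.length_cons, Nat.add_right_cancel_iff] at hlen
    rw [chase] at hl ⊢
    split_ifs at hl ⊢ with hc
    · simp only [PMF.support_pure, Set.mem_singleton_iff, List.cons.injEq, true_and] at hl
      simp [hl] at hlen
    · have hmap : ∀ y, (chase G Δ t prey L n (r + 1) y).map (fun l => x :: l) (x :: l) =
          chase G Δ t prey L n (r + 1) y l := by
        intro y
        rw [PMF.map_apply, tsum_eq_single l]
        · simp
        · intro l' hl'
          rw [if_neg]
          simpa using hl'.symm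
      rw [PMF.bind_apply, tsum_eq_single (l.getD 0 t)]
      · rw [hmap, Finset.prod_range_succ']
        rw [mul_comm]
        refine mul_le_mul' ?_ (by simp)
        refine (ih (r + 1) _ l hlen).trans (le_of_eq (Finset.prod_congr rfl fun i _ => ?_))
        rw [show r + 1 + i = r + (i + 1) by omega]
        simp
      · intro y hy
        rw [hmap]
        by_contra h
        obtain ⟨l', rfl⟩ := head_of_mem_support_chase
          ((PMF.mem_support_iff _ _).mpr (right_ne_zero_of_mul h))
        simp at hy

/-- If the pursuer cannot save any time, it may walk in the footsteps of its prey. -/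
theorem drop_mem_support_chase {Δ : ℕ} (hΔ : 1 < Δ) (P : ReflWalk G s t) (n r : ℕ)
    (hn : n + r = P.duration)
    (hlen : ∀ l ∈ (chase G Δ t P.pos P.duration n r (P.pos r)).support, l.length = n + 1) :
    P.1.drop r ∈ (chase G Δ t P.pos P.duration n r (P.pos r)).support := by
  have hPl := P.length_eq
  have hdrop : P.1.drop r = P.pos r :: P.1.drop (r + 1) := by
    rw [List.drop_eq_getElem_cons (by omega), ReflWalk.pos,
      List.getD_eq_getElem _ _ (by omega)]
  induction n generalizing r with
  | zero =>
    rw [hdrop, List.drop_eq_nil_of_le (by omega)]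
    simp [chase]
  | succ n ih =>
    rw [chase] at hlen ⊢
    split_ifs at hlen ⊢ with hc
    · simp at hlen
    · obtain ⟨w, hw⟩ := P.exists_walk_pos_add r Δ
      obtain ⟨q, hq⟩ : ∃ q : G.Walk (P.pos (r + 1)) (P.pos (r + Δ)),
          q.length ≤ min (Δ - 1) (P.duration - (r + 1)) := by
        have := P.exists_walk_pos_add (r + 1) (Δ - 1)
        rwa [show r + 1 + (Δ - 1) = r + Δ by omega] at this
      have hlow : n + 1 ≤ G.dist (P.pos r) (P.pos (r + Δ)) + (P.duration - (r + Δ)) := by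
        obtain ⟨l, hl⟩ := (chase G Δ t P.pos P.duration (n + 1) r (P.pos r)).support_nonempty
        refine le_dist_of_length_eq hΔ P hn w.reachable hl (hlen l ?_)
        rwa [chase, if_neg hc] at hl
      have hqd := G.dist_le q
      -- If `P` waited here, `q` would be a walk from `P.pos r` too short for `hlow`.
      have hadj : G.Adj (P.pos r) (P.pos (r + 1)) := by
        refine (P.pos_succ r).resolve_right fun h => ?_
        rw [h] at hlow
        omega
      have hd : G.dist (P.pos (r + 1)) (P.pos (r + Δ)) + 1 =
          G.dist (P.pos r) (P.pos (r + Δ)) := by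
        obtain ⟨q', hq'⟩ := q.reachable.exists_walk_length_eq_dist
        have := G.dist_le (SimpleGraph.Walk.cons hadj q')
        simp only [SimpleGraph.Walk.length_cons] at this
        omega
      have hy : P.pos (r + 1) ∈ (nextVertex G (P.pos r) (P.pos (r + Δ))).support :=
        (PMF.mem_support_iff _ _).mpr (nextVertex_ne_zero G hadj q.reachable hd)
      rw [hdrop, PMF.mem_support_bind_iff]
      refine ⟨P.pos (r + 1), hy, ?_⟩
      rw [PMF.mem_support_map_iff]
      refine ⟨_, ih (r + 1) (by omega) (fun l hl => ?_) ?_, rfl⟩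
      · have := hlen (P.pos r :: l) ((PMF.mem_support_bind_iff _ _ _).mpr
          ⟨_, hy, (PMF.mem_support_map_iff _ _ _).mpr ⟨l, hl, rfl⟩⟩)
        simpa using this
      · rw [List.drop_eq_getElem_cons (by omega), ReflWalk.pos,
          List.getD_eq_getElem _ _ (by omega)]

end Pursuit

end ChainPursuit

/-! ### Transition probabilities between walks of equal duration -/

namespace ChainPursuit

section Transition

variable {V : Type*} [Finite V] {G : SimpleGraph V} {s t : V} {Δ : ℕ}

theorem duration_le_of_mem_support (hΔ : 1 < Δ) {P Q : ReflWalk G s t}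
    (h : Q.1 ∈ (pursuitLaw G Δ P).support) : Q.duration ≤ P.duration := by
  classical
  have := chase_length_le P P.duration P.duration 0 s (by omega) (exists_walk_start P) Q.1 h
  have := Q.length_eq
  omega

theorem duration_le_of_canReach (hΔ : 1 < Δ) {P Q : ReflWalk G s t}
    (h : MarkovChain.CanReach (pursuitChain G Δ hΔ s t) P Q) : Q.duration ≤ P.duration := by
  obtain ⟨n, hn⟩ := h
  induction n generalizing Q with
  | zero =>
    have hQ : Q = P := by
      by_contra hne
      simp [MarkovChain.lawAfter, PMF.pure_apply, hne] at hn
    rw [hQ]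
  | succ n ih =>
    have hmem := (PMF.mem_support_iff _ _).mpr hn.ne'
    rw [MarkovChain.lawAfter, PMF.mem_support_bind_iff] at hmem
    obtain ⟨R, hR, hQ⟩ := hmem
    exact (duration_le_of_mem_support hΔ hQ).trans
      (ih (pos_iff_ne_zero.mpr ((PMF.mem_support_iff _ _).mp hR)))

theorem dist_of_mem_support (hΔ : 1 < Δ) {P Q : ReflWalk G s t}
    (h : Q.1 ∈ (pursuitLaw G Δ P).support) (hdur : Q.duration = P.duration) {i : ℕ}
    (hi : i ≤ P.duration) :
    G.dist (Q.pos i) (P.pos (i + Δ)) = min Δ (P.duration - i) := by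
  classical
  have h1 := (chase_full_length hΔ P P.duration 0 rfl s (exists_walk_start P) Q.1 h
    (by rw [Q.length_eq, hdur])).1 i hi
  rw [zero_add] at h1
  change G.dist (Q.pos i) _ + _ = _ at h1
  omega

/-- Before time `P.duration` the distance to the prey is positive, so the pursuer never waits. -/
theorem adj_of_mem_support (hΔ : 1 < Δ) {P Q : ReflWalk G s t}
    (h : Q.1 ∈ (pursuitLaw G Δ P).support) (hdur : Q.duration = P.duration) {i : ℕ}
    (hi : i < P.duration) :
    G.Adj (Q.pos i) (Q.pos (i + 1)) ∧
      G.dist (Q.pos (i + 1)) (P.pos (i + Δ)) + 1 = G.dist (Q.pos i) (P.pos (i + Δ)) := by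
  classical
  have hy := (chase_full_length hΔ P P.duration 0 rfl s (exists_walk_start P) Q.1 h
    (by rw [Q.length_eq, hdur])).2 i hi
  rw [zero_add] at hy
  change Q.pos (i + 1) ∈ (nextVertex G (Q.pos i) _).support at hy
  have hd := dist_of_mem_support hΔ h hdur hi.le
  obtain ⟨p, hp⟩ :=
    ((Q.reachable_pos i).symm.trans (P.reachable_pos (i + Δ))).exists_walk_length_eq_dist
  rcases nextVertex_support G p hy with ⟨h1, -⟩ | ⟨hadj, q, hq⟩
  · rw [h1, SimpleGraph.dist_self] at hd
    omega
  · refine ⟨hadj, ?_⟩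
    have h1 := G.dist_le q
    obtain ⟨q', hq'⟩ := q.reachable.exists_walk_length_eq_dist
    have h2 := G.dist_le (SimpleGraph.Walk.cons hadj q')
    rw [SimpleGraph.Walk.length_cons] at h2
    omega

theorem self_mem_support_pursuitLaw (hΔ : 1 < Δ) {P : ReflWalk G s t}
    (hdur : ∀ Q : ReflWalk G s t, Q.1 ∈ (pursuitLaw G Δ P).support → Q.duration = P.duration) :
    P.1 ∈ (pursuitLaw G Δ P).support := by
  classical
  have h := drop_mem_support_chase hΔ P P.duration 0 rfl
  rw [P.pos_zero] at h
  refine h fun l hl => ?_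
  have hl' : l ∈ (pursuitLaw G Δ P).support := hl
  have := hdur ⟨l, support_pursuitLaw hΔ P hl'⟩ hl'
  rw [← this]
  exact ReflWalk.length_eq ⟨l, support_pursuitLaw hΔ P hl'⟩

/-- Among walks that keep all distances, the transition probability is at most that of the
time-reversed pursuit. -/
theorem pursuitLaw_apply_le_reverse (hΔ : 1 < Δ) {P Q : ReflWalk G s t}
    (hP : P.1 ∈ (pursuitLaw G Δ P).support) (hdur : Q.duration = P.duration) :
    pursuitLaw G Δ P Q.1 ≤ ∏ j ∈ Finset.range P.duration,
      nextVertex G (P.pos (j + 1)) (Q.pos (j + 1 - Δ)) (P.pos j) := by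
  classical
  by_cases hPQ : Q.1 ∈ (pursuitLaw G Δ P).support
  swap
  · rw [PMF.mem_support_iff, not_not] at hPQ
    simp [hPQ]
  have hle : pursuitLaw G Δ P Q.1 ≤ _ :=
    chase_apply_le (t := t) P.duration 0 s Q.1 (by rw [Q.length_eq, hdur])
  refine hle.trans (le_of_eq ?_)
  simp only [zero_add]
  refine prod_nextVertex_eq_reverse G Δ P.duration Q.pos P.pos
    (fun i j => (Q.reachable_pos i).symm.trans (P.reachable_pos j)) ?_ (fun j hj => ?_)
    (fun r hr => adj_of_mem_support hΔ hPQ hdur hr) (fun j hj => ?_)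
  · rw [P.pos_zero, Q.pos_zero]
  · rw [P.pos_of_duration_le hj, Q.pos_of_duration_le hdur.le]
  · have hadj := (adj_of_mem_support hΔ hP rfl hj).1
    refine ⟨hadj.symm, ?_⟩
    rw [G.dist_comm (v := Q.pos _), G.dist_comm (v := Q.pos _)]
    -- For `j < Δ` the reversed prey is already at `s`, and the initial stretch of `P` is a geodesic
    -- because `P` can pursue itself. For `j ≥ Δ` the distances between `Q` and `P` are known.
    rcases lt_or_ge j Δ with hlt | hge
    · rw [show j + 1 - Δ = 0 by omega, Q.pos_zero.trans P.pos_zero.symm]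
      have h1 := (P.exists_walk_pos_add 0 j)
      rw [zero_add] at h1
      obtain ⟨w, hw⟩ := h1
      have h2 := G.dist_le w
      have h3 := dist_of_mem_support hΔ hP rfl (Nat.zero_le _)
      rw [zero_add] at h3
      obtain ⟨w1, hw1⟩ : ∃ w : G.Walk (P.pos (j + 1)) (P.pos Δ),
          w.length ≤ min (Δ - (j + 1)) (P.duration - (j + 1)) := by
        have := P.exists_walk_pos_add (j + 1) (Δ - (j + 1))
        rwa [show j + 1 + (Δ - (j + 1)) = Δ by omega] at this
      obtain ⟨w2, hw2⟩ := (w.reachable.trans hadj.reachable).exists_walk_length_eq_dist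
      have h4 := G.dist_le (w2.append w1)
      rw [SimpleGraph.Walk.length_append] at h4
      obtain ⟨w3, hw3⟩ := w.reachable.exists_walk_length_eq_dist
      have h5 := G.dist_le (w3.concat hadj)
      rw [SimpleGraph.Walk.length_concat] at h5
      omega
    · obtain ⟨r, rfl⟩ := Nat.exists_eq_add_of_le' hge
      have h1 := (adj_of_mem_support hΔ hPQ hdur (i := r) (by omega)).2
      have h2 := dist_of_mem_support hΔ hPQ hdur (i := r) (by omega)
      have h3 := dist_of_mem_support hΔ hPQ hdur (i := r + 1) (by omega)
      rw [show r + Δ + 1 - Δ = r + 1 by omega, show r + Δ + 1 = r + 1 + Δ by omega]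
      omega

/-- Reversed, distinct walks `P` are distinct trajectories of one time-dependent chain started at
`t` and chasing the reverse of `Q`; their total weight is at most 1. -/
theorem sum_pursuitLaw_le_one (hΔ : 1 < Δ) {C : Set (ReflWalk G s t)} [Fintype C]
    (hself : ∀ P ∈ C, P.1 ∈ (pursuitLaw G Δ P).support)
    (hdur : ∀ P ∈ C, ∀ Q ∈ C, Q.duration = P.duration) {Q : ReflWalk G s t} (hQ : Q ∈ C) :
    ∑ P : C, pursuitLaw G Δ P.1 Q.1 ≤ 1 := by
  classical
  have := Fintype.ofFinite V
  set L := Q.duration with hL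
  have hd : ∀ P : C, P.1.duration = L := fun P => hdur Q hQ P.1 P.2
  let rev : C → Fin (L + 1) → V := fun P i => P.1.pos (L - i)
  have hinj : Function.Injective rev := by
    intro P P' h
    refine Subtype.ext (ReflWalk.ext_pos ((hd P).trans (hd P').symm) fun i hi => ?_)
    rw [hd P] at hi
    have := congrFun h ⟨L - i, by omega⟩
    simpa [rev, Nat.sub_sub_self hi] using this
  -- Step `i` of the reversed chain goes from time `L - i` to `L - i - 1`; truncation parks the
  -- reversed `Q` at `s`.
  let k : ℕ → V → PMF V := fun i x => nextVertex G x (Q.pos (L - i - Δ))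
  have hle : ∀ P : C, pursuitLaw G Δ P.1 Q.1 ≤
      (if rev P 0 = t then
        ∏ i : Fin L, k i (rev P i.castSucc) (rev P i.succ) else 0) := by
    intro P
    have h0 : rev P 0 = t := by
      simpa [rev] using P.1.pos_of_duration_le (hd P).le
    rw [if_pos h0]
    refine (pursuitLaw_apply_le_reverse hΔ (hself P.1 P.2) (hd P).symm).trans (le_of_eq ?_)
    rw [hd P, ← Finset.prod_range_reflect, ← Fin.prod_univ_eq_prod_range (fun j =>
      nextVertex G (P.1.pos (L - 1 - j + 1)) (Q.pos (L - 1 - j + 1 - Δ)) (P.1.pos (L - 1 - j)))]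
    refine Finset.prod_congr rfl fun i _ => ?_
    simp only [k, rev, Fin.val_castSucc, Fin.val_succ]
    rw [show L - 1 - (i : ℕ) + 1 = L - i by omega, show L - (i + 1 : ℕ) = L - 1 - i by omega]
  refine (Finset.sum_le_sum fun P _ => hle P).trans ?_
  rw [← sum_prod_kernel k t L, ← tsum_fintype (L := .unconditional _),
    ← tsum_fintype (L := .unconditional _)]
  exact ENNReal.tsum_comp_le_tsum_of_injective hinj (fun w => if w 0 = t then
        ∏ i : Fin L, k i (w i.castSucc) (w i.succ) else 0)

theorem finite_of_duration_eq {C : Set (ReflWalk G s t)} (L : ℕ)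
    (h : ∀ P ∈ C, P.duration = L) : C.Finite := by
  refine Set.Finite.of_finite_image (f := Subtype.val)
    ((List.finite_length_eq V (L + 1)).subset ?_) Subtype.val_injective.injOn
  rintro _ ⟨P, hP, rfl⟩
  change P.1.length = L + 1
  rw [P.length_eq, h P hP]

end Transition

end ChainPursuit

theorem proposition4p1 {V : Type*} [Finite V] (G : SimpleGraph V) (Δ : ℕ) (hΔ : 1 < Δ) (s t : V)
    (C : Set (ChainPursuit.ReflWalk G s t))
    (hC : MarkovChain.IsClosedClass (ChainPursuit.pursuitChain G Δ hΔ s t) C) :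
    ∃ hfin : C.Finite,
      MarkovChain.IsLimitingDistribution
        (MarkovChain.restrict (ChainPursuit.pursuitChain G Δ hΔ s t) C hC)
        (@PMF.uniformOfFintype C hfin.fintype hC.nonempty.to_subtype) := by
  -- Durations never increase, and members of `C` reach each other both ways.
  have hdur : ∀ P ∈ C, ∀ Q ∈ C, Q.duration = P.duration := fun P hP Q hQ =>
    le_antisymm (ChainPursuit.duration_le_of_canReach hΔ (hC.communicates P hP Q hQ))
      (ChainPursuit.duration_le_of_canReach hΔ (hC.communicates Q hQ P hP))
  obtain ⟨P₀, hP₀⟩ := id hC.nonempty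
  have hfin : C.Finite := ChainPursuit.finite_of_duration_eq P₀.duration (hdur P₀ hP₀)
  refine ⟨hfin, ?_⟩
  let _ := hfin.fintype
  have := hC.nonempty.to_subtype
  have hself : ∀ P ∈ C, P.1 ∈ (ChainPursuit.pursuitLaw G Δ P).support := fun P hP =>
    ChainPursuit.self_mem_support_pursuitLaw hΔ fun Q hQ =>
      hdur P hP Q (hC.support_subset hP hQ)
  exact MarkovChain.isLimitingDistribution_of_stationary (MarkovChain.canReach_restrict hC)
    (fun P => (PMF.mem_support_iff _ _).mp (hself P.1 P.2))
    (MarkovChain.uniformOfFintype_bind_eq fun Q =>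
      ChainPursuit.sum_pursuitLaw_le_one hΔ hself hdur Q.2)
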